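/- All manifolds, metrics, connections and maps are smooth. A statistical manifold $(M,\nabla,g)$ is a manifold with a torsion-free affine connection $\nabla$ and a Riemannian metric $g$ such that $(\nabla_Xg)(Y,Z)=(\nabla_Yg)(X,Z)$; it is trivial if $\nabla$ is the Levi-Civita connection of $g$, and of constant curvature $k\in\mathbb{R}$ if the curvature tensor $R$ of $\nabla$ satisfies $R(X,Y)Z=k\{g(Y,Z)X-g(X,Z)Y\}$. A Hessian manifold is a statistical manifold of constant curvature $0$. It is of constant Hessian curvature $c\in\mathbb{R}$ if $(\nabla_XK)(Y,Z)=-\frac{c}{2}\{g(X,Y)Z+g(X,Z)Y\}$ for all vector fields $X,Y,Z$, where $K(X,Y)=\nabla_XY-\nabla^{\circ}_XY$ and $\nabla^{\circ}$ is the Levi-Civita connection of $g$. An immersion $f:M\to\tilde M$ between statistical manifolds $(M,\nabla,g)$ and $(\tilde M,\tilde\nabla,\tilde g)$ is a statistical immersion if $g=f^*\tilde g$ and $g(\nabla_XY,Z)=\tilde g(\tilde\nabla_Xf_*Y,f_*Z)$ for all vector fields $X,Y,Z$ on $M$. If it has codimension one and $\xi$ is a (possibly only locally defined) unit normal vector field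 of $f$, the one-form $\tau^*$ is defined by the Weingarten formula $\tilde\nabla_X\xi=-f_*A^*X+\tau^*(X)\xi$, in which $A^*$ is a tensor field of type $(1,1)$ on the domain of $\xi$. **Corollary.** Let $(M,\nabla,g)$ be a trivial statistical manifold of constant curvature $k$ with $\dim M\ge 2$, let $(\tilde M,\tilde\nabla,\tilde g)$ be a Hessian manifold of constant Hessian curvature $\tilde c\neq 0$, and let $f:M\to\tilde M$ be a statistical immersion of codimension one. Then $f$ is equiaffine, that is, $\tau^*=0$ for every unit normal vector field of $f$. -/

import Mathlib

open Bundle Manifold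
open scoped Manifold ContDiff Topology

noncomputable section

set_option linter.unusedSimpArgs false

namespace StatGeom

/-- The solution of the linear system behind the Koszul formula. -/
theorem exists_koszul {V : Type*} [NormedAddCommGroup V] [InnerProductSpace ℝ V]
    [FiniteDimensional ℝ V] (T : V → V → V → ℝ)
    (h₁ : ∀ a b c d, T (a + b) c d = T a c d + T b c d)
    (h₂ : ∀ a b c d, T a (b + c) d = T a b d + T a c d)
    (h₃ : ∀ a b c d, T a b (c + d) = T a b c + T a b d)
    (h₄ : ∀ (r : ℝ) a b c, T (r • a) b c = r * T a b c)
    (h₅ : ∀ (r : ℝ) a b c, T a (r • b) c = r * T a b c)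
    (h₆ : ∀ (r : ℝ) a b c, T a b (r • c) = r * T a b c) :
    ∃ A : V →ₗ[ℝ] V →ₗ[ℝ] V,
      ∀ σ X Z, inner ℝ (A σ X) Z = (1 / 2 : ℝ) * (T σ Z X + T X Z σ - T X σ Z) := by
  have : CompleteSpace V := FiniteDimensional.complete ℝ _
  let Φ : V → V → (V →ₗ[ℝ] ℝ) := fun σ X =>
    { toFun := fun Z => (1 / 2 : ℝ) * (T σ Z X + T X Z σ - T X σ Z)
      map_add' := fun a b => by simp only [h₁, h₂, h₃, h₄, h₅, h₆, smul_eq_mul, RingHom.id_apply]; ring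
      map_smul' := fun c a => by simp only [h₁, h₂, h₃, h₄, h₅, h₆, smul_eq_mul, RingHom.id_apply]; ring }
  let F : V → V → V := fun σ X =>
    (InnerProductSpace.toDual ℝ V).symm (LinearMap.toContinuousLinearMap (Φ σ X))
  have hF : ∀ σ X Z, inner ℝ (F σ X) Z = (1 / 2 : ℝ) * (T σ Z X + T X Z σ - T X σ Z) := by
    intro σ X Z
    simp only [F, InnerProductSpace.toDual_symm_apply]
    rfl
  let G : V →ₗ[ℝ] V →ₗ[ℝ] V :=
    LinearMap.mk₂ ℝ F
      (fun a b c => ext_inner_right ℝ fun Z => by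
        rw [inner_add_left, hF, hF, hF]; simp only [h₁, h₂, h₃, h₄, h₅, h₆]; ring)
      (fun c a b => ext_inner_right ℝ fun Z => by
        rw [real_inner_smul_left, hF, hF]; simp only [h₁, h₂, h₃, h₄, h₅, h₆]; ring)
      (fun a b c => ext_inner_right ℝ fun Z => by
        rw [inner_add_left, hF, hF, hF]; simp only [h₁, h₂, h₃, h₄, h₅, h₆]; ring)
      (fun c a b => ext_inner_right ℝ fun Z => by
        rw [real_inner_smul_left, hF, hF]; simp only [h₁, h₂, h₃, h₄, h₅, h₆]; ring)
  exact ⟨G, hF⟩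

section OneManifold

variable {E : Type*} [NormedAddCommGroup E] [NormedSpace ℝ E] [FiniteDimensional ℝ E]
  {H : Type*} [TopologicalSpace H] {I : ModelWithCorners ℝ E H}
  {M : Type*} [TopologicalSpace M] [ChartedSpace H M] [IsManifold I ∞ M]

/-- The curvature `R(X, Y)Z = ∇_X ∇_Y Z - ∇_Y ∇_X Z - ∇_[X, Y] Z` of an affine connection,
on vector fields. (In Mathlib `D Z x (X x)` is `∇_X Z` at `x`.) -/
def curvature (D : CovariantDerivative I E (fun x : M => TangentSpace I x))
    (X Y Z : (x : M) → TangentSpace I x) (x : M) : TangentSpace I x :=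
  D (fun y => D Z y (Y y)) x (X x) - D (fun y => D Z y (X y)) x (Y x)
    - D Z x (VectorField.mlieBracket I X Y x)

/-- The difference tensor `K(X, Y) = ∇_X Y - ∇°_X Y` of two affine connections. -/
def differenceTensor (D D₀ : CovariantDerivative I E (fun x : M => TangentSpace I x))
    (x : M) (X Y : TangentSpace I x) : TangentSpace I x :=
  D.difference D₀ x Y X

/-- The covariant derivative
`(∇_X K)(Y, Z) = ∇_X (K(Y, Z)) - K(∇_X Y, Z) - K(Y, ∇_X Z)` of a tensor `K` of type `(1, 2)`,
on vector fields. -/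
def covDerivTensor (D : CovariantDerivative I E (fun x : M => TangentSpace I x))
    (K : (x : M) → TangentSpace I x → TangentSpace I x → TangentSpace I x)
    (X Y Z : (x : M) → TangentSpace I x) (x : M) : TangentSpace I x :=
  D (fun y => K y (Y y) (Z y)) x (X x) - K x (D Y x (X x)) (Z x) - K x (Y x) (D Z x (X x))

variable [RiemannianBundle (fun x : M => TangentSpace I x)]
  [IsContMDiffRiemannianBundle I ∞ E (fun x : M => TangentSpace I x)]

/-- `(M, ∇, g)` is a statistical manifold: `∇` is a smooth torsion-free affine connection and
`(∇_X g)(Y, Z) = (∇_Y g)(X, Z)`.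
(In Mathlib `D.derivMetricTensor x Y Z X` is `(∇_X g)(Y, Z)` at `x`.) -/
structure IsStatistical (D : CovariantDerivative I E (fun x : M => TangentSpace I x)) : Prop where
  smooth : CovariantDerivative.ContMDiffCovariantDerivative D ∞
  torsion_eq_zero : D.torsion = 0
  codazzi : ∀ (x : M) (X Y Z : TangentSpace I x),
    D.derivMetricTensor x Y Z X = D.derivMetricTensor x X Z Y

/-- `D` is the Levi-Civita connection of `g`: torsion-free and metric. -/
structure IsLeviCivita (D : CovariantDerivative I E (fun x : M => TangentSpace I x)) : Prop where
  torsion_eq_zero : D.torsion = 0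
  metric : CovariantDerivative.IsMetricCompatible (V := fun x : M => TangentSpace I x) D

/-- `(∇_X g)(Y, Z)` is symmetric in `Y` and `Z`. -/
theorem derivMetricTensor_symm (D : CovariantDerivative I E (fun x : M => TangentSpace I x))
    (x : M) (σ τ X : TangentSpace I x) :
    D.derivMetricTensor x σ τ X = D.derivMetricTensor x τ σ X := by
  have h1 := CovariantDerivative.derivMetricTensor_apply_eq_extend
    (V := fun x : M => TangentSpace I x) D X σ τ
  have h2 := CovariantDerivative.derivMetricTensor_apply_eq_extend
    (V := fun x : M => TangentSpace I x) D X τ σ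
  have h3 : (fun y => inner ℝ (FiberBundle.extend (E := fun x : M => TangentSpace I x) E σ y)
      (FiberBundle.extend (E := fun x : M => TangentSpace I x) E τ y))
    = fun y => (inner ℝ (FiberBundle.extend (E := fun x : M => TangentSpace I x) E τ y)
      (FiberBundle.extend (E := fun x : M => TangentSpace I x) E σ y) : ℝ) :=
    funext fun y => real_inner_comm _ _
  rw [h3] at h1
  rw [h1, h2, real_inner_comm σ, real_inner_comm τ]
  ring

/-- The tensor that has to be added to `∇` to make it metric and keep its torsion. -/
theorem exists_koszulTensor (D : CovariantDerivative I E (fun x : M => TangentSpace I x)) (x : M) :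
    ∃ A : TangentSpace I x →L[ℝ] TangentSpace I x →L[ℝ] TangentSpace I x,
      ∀ σ X Z, inner ℝ (A σ X) Z = (1 / 2 : ℝ) * (D.derivMetricTensor x σ Z X
        + D.derivMetricTensor x X Z σ - D.derivMetricTensor x X σ Z) := by
  have hfin : ∀ x : M, FiniteDimensional ℝ (TangentSpace I x) :=
    fun _ => inferInstanceAs (FiniteDimensional ℝ E)
  have := hfin x
  obtain ⟨A, hA⟩ := exists_koszul (V := TangentSpace I x)
    (fun σ τ X => D.derivMetricTensor x σ τ X)
    (fun a b c d => congrArg (fun L => L c d) ((D.derivMetricTensor x).map_add a b))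
    (fun a b c d => congrArg (fun L => L d) ((D.derivMetricTensor x a).map_add b c))
    (fun a b c d => (D.derivMetricTensor x a b).map_add c d)
    (fun r a b c => congrArg (fun L => L b c) ((D.derivMetricTensor x).map_smul r a))
    (fun r a b c => congrArg (fun L => L c) ((D.derivMetricTensor x a).map_smul r b))
    (fun r a b c => (D.derivMetricTensor x a b).map_smul r c)
  exact ⟨LinearMap.toContinuousLinearMap
    (LinearMap.toContinuousLinearMap.toLinearMap ∘ₗ A), hA⟩

/-- A torsion-free affine connection on a Riemannian manifold yields the Levi-Civita connection. -/
theorem exists_isLeviCivita (D : CovariantDerivative I E (fun x : M => TangentSpace I x))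
    (hD : D.torsion = 0) :
    ∃ D₀ : CovariantDerivative I E (fun x : M => TangentSpace I x), IsLeviCivita D₀ := by
  obtain ⟨T, hT0⟩ : ∃ T : ∀ x : M, TangentSpace I x → TangentSpace I x → TangentSpace I x → ℝ,
      ∀ x σ τ X, T x σ τ X = D.derivMetricTensor x σ τ X := ⟨_, fun _ _ _ _ => rfl⟩
  have hsymm : ∀ (x : M) (σ τ X : TangentSpace I x), T x σ τ X = T x τ σ X :=
    fun x σ τ X => by rw [hT0, hT0]; exact derivMetricTensor_symm D x σ τ X
  have hA : ∀ x : M, ∃ A : TangentSpace I x →L[ℝ] TangentSpace I x →L[ℝ] TangentSpace I x,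
      ∀ σ X Z, inner ℝ (A σ X) Z = (1 / 2 : ℝ) * (T x σ Z X + T x X Z σ - T x X σ Z) := by
    intro x
    simp only [hT0]
    exact exists_koszulTensor D x
  choose A hA using hA
  refine ⟨D.addOneForm A, ?_, ?_⟩
  · rw [CovariantDerivative.torsion_eq_zero_iff]
    intro X Y x hX hY
    rw [← (CovariantDerivative.torsion_eq_zero_iff D).1 hD hX hY]
    have : A x (Y x) (X x) = A x (X x) (Y x) := by
      refine ext_inner_right ℝ fun Z => ?_
      rw [hA, hA, hsymm x (X x) (Y x) Z]
      ring
    simp only [CovariantDerivative.addOneForm, add_apply, this]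
    abel
  · rw [CovariantDerivative.isMetricCompatible_iff]
    intro x X σ τ hX hσ hτ
    have h := CovariantDerivative.derivMetricTensor_apply (V := fun x : M => TangentSpace I x)
      (X := X) D x hσ hτ
    rw [← hT0] at h
    have e1 := hA x (σ x) (X x) (τ x)
    have e2 := hA x (τ x) (X x) (σ x)
    have s1 := hsymm x (σ x) (τ x) (X x)
    have e3 : inner ℝ (σ x) (A x (τ x) (X x)) = inner ℝ (A x (τ x) (X x)) (σ x) :=
      real_inner_comm _ _
    simp only [CovariantDerivative.addOneForm, add_apply, inner_add_left, inner_add_right]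
    rw [e1, e3, e2]
    linear_combination s1 / 2 - h

/-- `(M, ∇, g)` is a trivial (Riemannian) statistical manifold: `∇` is the Levi-Civita connection
of `g`. -/
structure IsTrivialStatistical (D : CovariantDerivative I E (fun x : M => TangentSpace I x)) :
    Prop where
  statistical : IsStatistical D
  leviCivita : IsLeviCivita D

/-- `(M, ∇, g)` is of constant curvature `k`: `R(X, Y)Z = k (g(Y, Z)X - g(X, Z)Y)`. -/
def HasConstantCurvature (D : CovariantDerivative I E (fun x : M => TangentSpace I x)) (k : ℝ) :
    Prop :=
  ∀ X Y Z : (x : M) → TangentSpace I x, CMDiff ∞ (T% X) → CMDiff ∞ (T% Y) → CMDiff ∞ (T% Z) →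
    ∀ x : M, curvature D X Y Z x
      = k • (inner ℝ (Y x) (Z x) • X x - inner ℝ (X x) (Z x) • Y x)

/-- `(M, ∇, g)` is a Hessian manifold: a statistical manifold of constant curvature `0`. -/
structure IsHessian (D : CovariantDerivative I E (fun x : M => TangentSpace I x)) : Prop where
  statistical : IsStatistical D
  flat : HasConstantCurvature D 0

/-- `(M, ∇, g)` is of constant Hessian curvature `c`: for the difference tensor `K = ∇ - ∇°` of
`∇` and the Levi-Civita connection `∇°` of `g` (which exists by `exists_isLeviCivita`),
`(∇_X K)(Y, Z) = -(c/2) (g(X, Y)Z + g(X, Z)Y)`. -/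
def HasConstantHessianCurvature
    (D : CovariantDerivative I E (fun x : M => TangentSpace I x)) (c : ℝ) : Prop :=
  ∃ D₀ : CovariantDerivative I E (fun x : M => TangentSpace I x), IsLeviCivita D₀ ∧
    ∀ X Y Z : (x : M) → TangentSpace I x, CMDiff ∞ (T% X) → CMDiff ∞ (T% Y) → CMDiff ∞ (T% Z) →
      ∀ x : M, covDerivTensor D (differenceTensor D D₀) X Y Z x
        = (-(c / 2)) • (inner ℝ (X x) (Y x) • Z x + inner ℝ (X x) (Z x) • Y x)

end OneManifold

section Immersion

/-- A hyperplane that is orthogonal to a unit vector `ξ` is the orthogonal complement of `ξ`. -/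
theorem exists_eq_of_orthogonal {A B : Type*} [AddCommGroup A] [Module ℝ A]
    [FiniteDimensional ℝ A] [NormedAddCommGroup B] [InnerProductSpace ℝ B] [FiniteDimensional ℝ B]
    (hdim : Module.finrank ℝ B = Module.finrank ℝ A + 1) (L : A →ₗ[ℝ] B)
    (hL : ∀ u, L u = 0 → u = 0) (ξ : B) (hξ : inner ℝ ξ ξ = (1 : ℝ))
    (hn : ∀ a, inner ℝ (L a) ξ = (0 : ℝ)) (w : B) (hw : inner ℝ w ξ = (0 : ℝ)) :
    ∃ a, L a = w := by
  have hξ0 : ξ ≠ 0 := by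
    rintro rfl
    simp at hξ
  have hle : LinearMap.range L ≤ (ℝ ∙ ξ)ᗮ := by
    rintro _ ⟨a, rfl⟩
    rw [Submodule.mem_orthogonal_singleton_iff_inner_left]
    exact hn a
  have heq : LinearMap.range L = (ℝ ∙ ξ)ᗮ := by
    apply Submodule.eq_of_le_of_finrank_eq hle
    have h1 := Submodule.finrank_add_finrank_orthogonal (ℝ ∙ ξ)
    rw [finrank_span_singleton hξ0] at h1
    rw [LinearMap.finrank_range_of_inj
      (LinearMap.ker_eq_bot.1 (LinearMap.ker_eq_bot'.2 hL))]
    omega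
  have : w ∈ LinearMap.range L := by
    rw [heq, Submodule.mem_orthogonal_singleton_iff_inner_left]
    exact hw
  exact this

variable {E : Type*} [NormedAddCommGroup E] [NormedSpace ℝ E] [FiniteDimensional ℝ E]
  {H : Type*} [TopologicalSpace H] {I : ModelWithCorners ℝ E H}
  {M : Type*} [TopologicalSpace M] [ChartedSpace H M] [IsManifold I ∞ M]
  {E' : Type*} [NormedAddCommGroup E'] [NormedSpace ℝ E'] [FiniteDimensional ℝ E']
  {H' : Type*} [TopologicalSpace H'] {J : ModelWithCorners ℝ E' H'}
  {N : Type*} [TopologicalSpace N] [ChartedSpace H' N] [IsManifold J ∞ N]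

/-- The derivative `∇_v V` at `x` of a vector field `V` along `f : M → N`, for the pull-back to `M`
of an affine connection on `N`. With the local frame `(e_a)` of `TN` near `f x` given by the
preferred trivialization there, and `V = ∑ V^a e_a ∘ f` near `x`, it is
`∑ dV^a(v) e_a + V^a(x) ∇_{df v} e_a`; the second part is the derivative along `df v` of the vector
field on `N` that has the constant coefficients `V^a(x)`. -/
def covAlong (D : CovariantDerivative J E' (fun y : N => TangentSpace J y)) (f : M → N)
    (V : (x : M) → TangentSpace J (f x)) (x : M) : TangentSpace I x →L[ℝ] TangentSpace J (f x) :=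
  let e := trivializationAt E' (fun y : N => TangentSpace J y) (f x)
  (e.symmL ℝ (f x)) ∘L (mvfderiv I (fun z : M => (e ⟨f z, V z⟩).2) x)
    + (D (fun y : N => e.symm y (e ⟨f x, V x⟩).2) (f x)) ∘L (mfderiv I J f x)

variable [RiemannianBundle (fun x : M => TangentSpace I x)]
  [RiemannianBundle (fun y : N => TangentSpace J y)]

/-- `f : (M, ∇, g) → (N, ∇', g')` is a statistical immersion: an immersion such that `(∇, g)` is the
structure induced by `f`, i.e. `g = f^* g'` and `g(∇_X Y, Z) = g'(∇'_X f_*Y, f_*Z)`. -/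
structure IsStatisticalImmersion (D : CovariantDerivative I E (fun x : M => TangentSpace I x))
    (D' : CovariantDerivative J E' (fun y : N => TangentSpace J y)) (f : M → N) : Prop where
  immersion : IsImmersion I J ∞ f
  metric : ∀ (x : M) (u v : TangentSpace I x),
    inner ℝ u v = inner ℝ (mfderiv I J f x u) (mfderiv I J f x v)
  connection : ∀ Y : (x : M) → TangentSpace I x, CMDiff ∞ (T% Y) →
    ∀ (x : M) (u w : TangentSpace I x),
      inner ℝ (D Y x u) w
        = inner ℝ (covAlong (I := I) D' f (fun z => mfderiv I J f z (Y z)) x u)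
            (mfderiv I J f x w)

/-- `ξ` is, on the set `U`, a smooth unit normal vector field of `f : M → N`. -/
structure IsUnitNormalOn (I : ModelWithCorners ℝ E H) (f : M → N)
    (ξ : (x : M) → TangentSpace J (f x)) (U : Set M) : Prop where
  smooth : ContMDiffOn I J.tangent ∞ (fun x => (⟨f x, ξ x⟩ : TangentBundle J N)) U
  unit : ∀ x ∈ U, inner ℝ (ξ x) (ξ x) = (1 : ℝ)
  normal : ∀ x ∈ U, ∀ v : TangentSpace I x, inner ℝ (mfderiv I J f x v) (ξ x) = (0 : ℝ)

/-- The one-form `τ*` of the Weingarten formula `∇'_X ξ = -f_* A* X + τ*(X) ξ`, i.e. the normal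
component of `∇'_X ξ` (see `weingarten_iff`). -/
def tauStar (D' : CovariantDerivative J E' (fun y : N => TangentSpace J y)) (f : M → N)
    (ξ : (x : M) → TangentSpace J (f x)) (x : M) (v : TangentSpace I x) : ℝ :=
  inner ℝ (covAlong (I := I) D' f ξ x v) (ξ x)

/-- In codimension one, `τ*(v)` is the unique number `t` for which the Weingarten formula
`∇'_v ξ = -f_* a + t ξ` holds with some tangent vector `a`. -/
theorem weingarten_iff
    (hdim : Module.finrank ℝ E' = Module.finrank ℝ E + 1)
    {D : CovariantDerivative I E (fun x : M => TangentSpace I x)}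
    {D' : CovariantDerivative J E' (fun y : N => TangentSpace J y)} {f : M → N}
    (hf : IsStatisticalImmersion D D' f)
    {ξ : (x : M) → TangentSpace J (f x)} {U : Set M} (hξ : IsUnitNormalOn I f ξ U)
    {x : M} (hx : x ∈ U) (v : TangentSpace I x) (t : ℝ) :
    (∃ a : TangentSpace I x, covAlong (I := I) D' f ξ x v = -(mfderiv I J f x a) + t • ξ x)
      ↔ t = tauStar (I := I) D' f ξ x v := by
  have h1 := hξ.unit x hx
  have h2 := hξ.normal x hx
  constructor
  · rintro ⟨a, ha⟩
    rw [tauStar, ha, inner_add_left, inner_neg_left, real_inner_smul_left, h1, h2 a]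
    ring
  · intro ht
    have : FiniteDimensional ℝ (TangentSpace I x) := inferInstanceAs (FiniteDimensional ℝ E)
    have : FiniteDimensional ℝ (TangentSpace J (f x)) := inferInstanceAs (FiniteDimensional ℝ E')
    have hdim' : Module.finrank ℝ (TangentSpace J (f x)) = Module.finrank ℝ (TangentSpace I x) + 1 :=
      hdim
    have hinj : ∀ u : TangentSpace I x, mfderiv I J f x u = 0 → u = 0 := fun u hu => by
      have := hf.metric x u u
      rw [hu, inner_zero_left] at this
      exact inner_self_eq_zero.1 this
    obtain ⟨a, ha⟩ := exists_eq_of_orthogonal hdim'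
      (mfderiv I J f x).toLinearMap hinj (ξ x) h1 h2
      (covAlong (I := I) D' f ξ x v - t • ξ x)
      (by rw [inner_sub_left, real_inner_smul_left, h1, ht, tauStar]; ring)
    refine ⟨-a, ?_⟩
    have ha' : mfderiv I J f x a = covAlong (I := I) D' f ξ x v - t • ξ x := ha
    rw [map_neg, ha']
    abel

/-- `f : M → (N, ∇', g')` is equiaffine: `τ*` vanishes, for every unit normal vector field of `f`.
Since unit normal vector fields may exist only locally, those defined on open sets are included. -/
def IsEquiaffine (I : ModelWithCorners ℝ E H)
    (D' : CovariantDerivative J E' (fun y : N => TangentSpace J y)) (f : M → N) : Prop :=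
  ∀ (U : Set M) (ξ : (x : M) → TangentSpace J (f x)), IsOpen U → IsUnitNormalOn I f ξ U →
    ∀ x ∈ U, ∀ v : TangentSpace I x, tauStar (I := I) D' f ξ x v = 0

end Immersion

end StatGeom

end

/-!
The point is that, because `M` carries its Levi-Civita connection, the whole question is algebraic
at a single point of `N`. Let `K = ∇' - ∇°` be the difference tensor of the ambient manifold. Its
cubic form `g(K(X, Y), Z)` is totally symmetric and equals `-(1/2) (∇'g)(Y, Z; X)`
(`inner_differenceTensor`).

* Constant Hessian curvature `c` gives a Gauss type identity for `K`
  (`HasConstantHessianCurvature.exists_isLeviCivita_gauss`):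
  `g(K(u, v), K(w, z)) - g(K(u, w), K(v, z)) = (c/4) (g(u, v) g(w, z) - g(u, w) g(v, z))`.
  It says that the derivative of the function `g(K(Y, Z), W)`, expanded by the product rule,
  is symmetric in `Y` and `W`. Only `∇'g` and the formula for `∇'K` enter; the product rule needs
  `K(Y, Z)` to be a smooth vector field, which follows from the smoothness of its cubic form
  (`contMDiff_differenceTensor`), since the connection `∇°` is not assumed to be smooth.
* The product rule for `g` along `f` (`mvfderiv_inner_along`) identifies two components of the cubic
  form at points of `f`: the purely tangential one vanishes, as both `∇` and the metric are induced
  and `∇` is metric (`IsStatisticalImmersion.derivMetricTensor_eq_zero`), and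
  `τ*(v) = g(K(f_* v, ξ), ξ)`, as `ξ` has constant length (`IsUnitNormalOn.tauStar_eq`).
* Hence `K(Y, Z) = b(Y, Z) ξ` on tangent vectors, and the identity above with one normal argument
  becomes `b(Y, Z) τ*(X) = b(X, Y) τ*(Z)`. If `τ* ≠ 0`, a nonzero `Z` with `τ*(Z) = 0`, which exists
  as `dim M ≥ 2`, would lie in the kernel of `b`; but the tangential part of the identity,
  `b(Z, Z) b(Y, Y) - b(Z, Y)² = (c/4) (|Z|² |Y|² - g(Z, Y)²)`, excludes this
  (`inner_normal_eq_zero_of_gauss`).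
-/

namespace StatGeom

/-! ### Smooth vector fields -/

section Sections

variable {E : Type*} [NormedAddCommGroup E] [NormedSpace ℝ E] [FiniteDimensional ℝ E]
  {H : Type*} [TopologicalSpace H] {I : ModelWithCorners ℝ E H}
  {M : Type*} [TopologicalSpace M] [ChartedSpace H M] [IsManifold I ∞ M]

/-- A vector field that is smooth near `x` agrees near `x` with a globally smooth one. -/
theorem exists_contMDiff_eventuallyEq [T2Space M] {σ : (x : M) → TangentSpace I x} {u : Set M}
    {x : M} (hu : u ∈ 𝓝 x) (hσ : CMDiff[u] ∞ (T% σ)) :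
    ∃ X : (x : M) → TangentSpace I x, CMDiff ∞ (T% X) ∧ ∀ᶠ y in 𝓝 x, X y = σ y := by
  obtain ⟨ψ, -, hψ⟩ := (SmoothBumpFunction.nhds_basis_tsupport (I := I) x).mem_iff.1
    (interior_mem_nhds.2 hu)
  refine ⟨(ψ : M → ℝ) • σ, (ψ.contMDiff.contMDiffOn (s := interior u)).smul_section_of_tsupport
    isOpen_interior hψ (hσ.mono interior_subset), ?_⟩
  filter_upwards [ψ.eventuallyEq_one] with y hy
  simp [hy]

theorem exists_contMDiff_extend [T2Space M] {x : M} (v : TangentSpace I x) :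
    ∃ X : (x : M) → TangentSpace I x, CMDiff ∞ (T% X) ∧ X x = v := by
  obtain ⟨u, hu, h⟩ := FiberBundle.exists_contMDiffOn_extend (k := ∞) I E
    (V := fun x : M => TangentSpace I x) v
  obtain ⟨X, hX, hXe⟩ := exists_contMDiff_eventuallyEq hu h
  exact ⟨X, hX, by rw [hXe.self_of_nhds, FiberBundle.extend_apply_self]⟩

omit [FiniteDimensional ℝ E] in
theorem contMDiff_mvfderiv_apply {φ : M → ℝ} (hφ : CMDiff ∞ φ) {X : (x : M) → TangentSpace I x}
    (hX : CMDiff ∞ (T% X)) : CMDiff ∞ (fun x => mvfderiv I φ x (X x)) :=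
  (contMDiff_snd_tangentBundle_modelSpace ℝ 𝓘(ℝ, ℝ)).comp
    ((hφ.contMDiff_tangentMap (m := ∞) le_rfl).comp hX)

variable [RiemannianBundle (fun x : M => TangentSpace I x)]
  [IsContMDiffRiemannianBundle I ∞ E (fun x : M => TangentSpace I x)]

omit [FiniteDimensional ℝ E] in
theorem contMDiff_inner {X Y : (x : M) → TangentSpace I x} (hX : CMDiff ∞ (T% X))
    (hY : CMDiff ∞ (T% Y)) : CMDiff ∞ (fun x => (inner ℝ (X x) (Y x) : ℝ)) :=
  ContMDiff.inner_bundle (F := E) (E := fun x : M => TangentSpace I x) (v := X) (w := Y) hX hY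

omit [FiniteDimensional ℝ E] in
theorem mdifferentiableAt_inner {E₁ : Type*} [NormedAddCommGroup E₁] [NormedSpace ℝ E₁]
    {H₁ : Type*} [TopologicalSpace H₁] {I₁ : ModelWithCorners ℝ E₁ H₁}
    {M₁ : Type*} [TopologicalSpace M₁] [ChartedSpace H₁ M₁] {f : M₁ → M}
    {V W : (z : M₁) → TangentSpace I (f z)} {z : M₁}
    (hV : MDifferentiableAt I₁ I.tangent (fun z => (⟨f z, V z⟩ : TangentBundle I M)) z)
    (hW : MDifferentiableAt I₁ I.tangent (fun z => (⟨f z, W z⟩ : TangentBundle I M)) z) :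
    MDifferentiableAt I₁ 𝓘(ℝ, ℝ) (fun z => (inner ℝ (V z) (W z) : ℝ)) z := by
  have : IsContMDiffRiemannianBundle I 1 E (fun x : M => TangentSpace I x) :=
    IsContMDiffRiemannianBundle.of_le (n := ∞) (by simp)
  exact MDifferentiableAt.inner_bundle (IB := I) (F := E) (E := fun x : M => TangentSpace I x)
    (v := V) (w := W) hV hW

/-- A vector field is smooth if its inner products with all smooth vector fields are. In a local
frame its coefficients are obtained from these inner products by inverting the Gram matrix. -/
theorem contMDiffAt_of_inner [T2Space M] {S : (x : M) → TangentSpace I x} {x : M}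
    (hS : ∀ X : (x : M) → TangentSpace I x, CMDiff ∞ (T% X) →
      CMDiffAt ∞ (fun y => (inner ℝ (S y) (X y) : ℝ)) x) :
    CMDiffAt ∞ (T% S) x := by
  let e := trivializationAt E (fun y : M => TangentSpace I y) x
  obtain ⟨n, ⟨b⟩⟩ : ∃ n : ℕ, Nonempty (Module.Basis (Fin n) ℝ E) := ⟨_, ⟨Module.finBasis ℝ E⟩⟩
  have hx : x ∈ e.baseSet := FiberBundle.mem_baseSet_trivializationAt' x
  have hex : ∀ i, ∃ X : (x : M) → TangentSpace I x, CMDiff ∞ (T% X) ∧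
      ∀ᶠ y in 𝓝 x, X y = e.localFrame b i y := fun i =>
    exists_contMDiff_eventuallyEq (e.open_baseSet.mem_nhds hx)
      (e.contMDiffOn_localFrame_baseSet (n := ∞) b i)
  choose X hX hXe using hex
  let coeff : M → Fin n → ℝ := fun y i => e.localFrameCoeff I b i y (S y)
  -- `G y` is the Gram matrix of the frame `X` at `y`, as an endomorphism: `G y (coeff y) = φ y`.
  let G : M → (Fin n → ℝ) →L[ℝ] (Fin n → ℝ) := fun y => ∑ i, ∑ j, (inner ℝ (X i y) (X j y) : ℝ) •
    ((ContinuousLinearMap.proj i : (Fin n → ℝ) →L[ℝ] ℝ).smulRight (Pi.single j (1 : ℝ)))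
  let φ : M → Fin n → ℝ := fun y j => inner ℝ (S y) (X j y)
  have hG : CMDiffAt ∞ G x := by
    refine contMDiffAt_finsetSum fun i _ => contMDiffAt_finsetSum fun j _ => ?_
    exact (contMDiff_inner (hX i) (hX j)).contMDiffAt.smul contMDiffAt_const
  have hφ : ContMDiffAt I 𝓘(ℝ, Fin n → ℝ) ∞ φ x := contMDiffAt_pi_space.2 fun j => hS (X j) (hX j)
  have hGa : ∀ y a j, G y a j = inner ℝ (∑ i, a i • X i y) (X j y) := by
    intro y a j
    simp [G, Finset.sum_apply, sum_inner, real_inner_smul_left, Pi.single_apply, mul_comm]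
  -- The frame is linearly independent near `x`, so the Gram matrix is invertible there.
  have hunit : ∀ᶠ y in 𝓝 x, ∃ L : (Fin n → ℝ) ≃L[ℝ] (Fin n → ℝ), (L : (Fin n → ℝ) →L[ℝ] (Fin n → ℝ)) = G y := by
    filter_upwards [e.open_baseSet.mem_nhds hx, Filter.eventually_all.2 hXe] with y hy hXy
    have hinj : Function.Injective (G y) := by
      rw [injective_iff_map_eq_zero]
      intro a ha
      have h0 : ∑ i, a i • X i y = 0 := by
        rw [← inner_self_eq_zero (𝕜 := ℝ)]
        conv_lhs => rw [inner_sum]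
        refine Finset.sum_eq_zero fun j _ => ?_
        rw [real_inner_smul_right, ← hGa, ha]
        simp
      have hli := (e.basisAt b hy).linearIndependent
      rw [Fintype.linearIndependent_iff] at hli
      funext i
      refine hli a ?_ i
      rw [← h0]
      simp [hXy, hy]
    exact ⟨(LinearEquiv.ofInjectiveEndo (G y).toLinearMap hinj).toContinuousLinearEquiv, by
      ext; rfl⟩
  have hcoeff : ContMDiffAt I 𝓘(ℝ, Fin n → ℝ) ∞ coeff x := by
    have h1 : ContMDiffAt I 𝓘(ℝ, Fin n → ℝ) ∞ (fun y => (G y).inverse (φ y)) x := by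
      obtain ⟨L, hL⟩ := hunit.self_of_nhds
      have h2 := contDiffAt_map_inverse (n := ∞) L
      rw [hL] at h2
      exact (h2.contMDiffAt.comp x hG).clm_apply hφ
    refine h1.congr_of_eventuallyEq ?_
    filter_upwards [hunit, e.open_baseSet.mem_nhds hx, Filter.eventually_all.2 hXe]
      with y ⟨L, hL⟩ hy hXy
    have : G y (coeff y) = φ y := by
      funext j
      rw [hGa]
      congr 1
      rw [e.eq_sum_localFrameCoeff_smul (I := I) (b := b) (s := S) hy]
      simp only [hXy, coeff]
    rw [← this, ← hL]
    simp
  rw [contMDiffAt_iff_localFrameCoeff b hx]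
  exact fun i => contMDiffAt_pi_space.1 hcoeff i

end Sections

/-! ### The difference tensor of a statistical manifold -/

section Statistical

variable {E : Type*} [NormedAddCommGroup E] [NormedSpace ℝ E] [FiniteDimensional ℝ E]
  {H : Type*} [TopologicalSpace H] {I : ModelWithCorners ℝ E H}
  {M : Type*} [TopologicalSpace M] [ChartedSpace H M] [IsManifold I ∞ M]
  {D D₀ : CovariantDerivative I E (fun x : M => TangentSpace I x)}

theorem differenceTensor_apply {x : M} (v : TangentSpace I x) {Y : (x : M) → TangentSpace I x}
    (hY : MDiffAt (T% Y) x) : differenceTensor D D₀ x v (Y x) = D Y x v - D₀ Y x v := by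
  rw [differenceTensor, CovariantDerivative.difference,
    IsCovariantDerivativeOn.difference_apply _ _ (by trivial) hY]
  rfl

theorem differenceTensor_symm (h : D.torsion = 0) (h₀ : D₀.torsion = 0) (x : M)
    (u v : TangentSpace I x) : differenceTensor D D₀ x u v = differenceTensor D D₀ x v u := by
  have hu := FiberBundle.mdifferentiableAt_extend I E (V := fun x : M => TangentSpace I x) u
  have hv := FiberBundle.mdifferentiableAt_extend I E (V := fun x : M => TangentSpace I x) v
  have e1 := differenceTensor_apply (D := D) (D₀ := D₀) v hu
  have e2 := differenceTensor_apply (D := D) (D₀ := D₀) u hv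
  have e3 := (D.torsion_eq_zero_iff).1 h hu hv
  have e4 := (D₀.torsion_eq_zero_iff).1 h₀ hu hv
  simp only [FiberBundle.extend_apply_self] at e1 e2 e3 e4
  rw [e1, e2, sub_eq_sub_iff_sub_eq_sub, e3, e4]

variable [RiemannianBundle (fun x : M => TangentSpace I x)]
  [IsContMDiffRiemannianBundle I ∞ E (fun x : M => TangentSpace I x)]

/-- The product rule `v⟨X, Y⟩ = (∇_v g)(X, Y) + ⟨∇_v X, Y⟩ + ⟨X, ∇_v Y⟩`. -/
theorem mvfderiv_inner {X Y : (x : M) → TangentSpace I x} {x : M}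
    (hX : MDiffAt (T% X) x) (hY : MDiffAt (T% Y) x) (v : TangentSpace I x) :
    mvfderiv I (fun y => (inner ℝ (X y) (Y y) : ℝ)) x v
      = D.derivMetricTensor x (X x) (Y x) v + inner ℝ (D X x v) (Y x)
        + inner ℝ (X x) (D Y x v) := by
  have h := CovariantDerivative.derivMetricTensor_apply (V := fun x : M => TangentSpace I x)
    (X := FiberBundle.extend (E := fun x : M => TangentSpace I x) E v) D x hX hY
  simp only [FiberBundle.extend_apply_self] at h
  rw [h]
  ring

/-- `∇° g = 0`, so `∇g` is the action of `∇ - ∇°` on `g`. -/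
theorem derivMetricTensor_eq (h₀ : IsLeviCivita D₀) (x : M) (u v w : TangentSpace I x) :
    D.derivMetricTensor x u v w
      = -(inner ℝ (differenceTensor D D₀ x w u) v + inner ℝ u (differenceTensor D D₀ x w v)) := by
  have hu := FiberBundle.mdifferentiableAt_extend I E (V := fun x : M => TangentSpace I x) u
  have hv := FiberBundle.mdifferentiableAt_extend I E (V := fun x : M => TangentSpace I x) v
  have e1 := mvfderiv_inner (D := D) hu hv w
  have e2 := mvfderiv_inner (D := D₀) hu hv w
  have e3 := differenceTensor_apply (D := D) (D₀ := D₀) w hu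
  have e4 := differenceTensor_apply (D := D) (D₀ := D₀) w hv
  have e5 : D₀.derivMetricTensor x u v w = 0 := congr($(h₀.metric) x u v w)
  simp only [FiberBundle.extend_apply_self] at e1 e2 e3 e4
  rw [e3, e4, inner_sub_left, inner_sub_right]
  linarith

/-- Together with `differenceTensor_symm`, this makes the cubic form `⟨K(u, v), w⟩` totally
symmetric. -/
theorem inner_differenceTensor_comm (hD : IsStatistical D) (h₀ : IsLeviCivita D₀) (x : M)
    (u v w : TangentSpace I x) :
    (inner ℝ (differenceTensor D D₀ x u v) w : ℝ) = inner ℝ (differenceTensor D D₀ x u w) v := by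
  have hs := differenceTensor_symm hD.torsion_eq_zero h₀.torsion_eq_zero x
  have e := hD.codazzi x v w u
  rw [derivMetricTensor_eq h₀, derivMetricTensor_eq h₀, hs w v, real_inner_comm _ w,
    real_inner_comm _ v] at e
  rw [hs u v, hs u w]
  linarith

theorem inner_differenceTensor (hD : IsStatistical D) (h₀ : IsLeviCivita D₀) (x : M)
    (u v w : TangentSpace I x) :
    (inner ℝ (differenceTensor D D₀ x u v) w : ℝ) = -(1 / 2) * D.derivMetricTensor x v w u := by
  rw [derivMetricTensor_eq h₀, real_inner_comm _ v, inner_differenceTensor_comm hD h₀ x u w v]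
  ring

omit [FiniteDimensional ℝ E] [IsContMDiffRiemannianBundle I ∞ E (fun x : M => TangentSpace I x)]
  [RiemannianBundle (fun x : M => TangentSpace I x)] in
theorem contMDiff_covariantDerivative_apply
    (hD : CovariantDerivative.ContMDiffCovariantDerivative D ∞) {X Y : (x : M) → TangentSpace I x}
    (hX : CMDiff ∞ (T% X)) (hY : CMDiff ∞ (T% Y)) : CMDiff ∞ (T% (fun x => D Y x (X x))) := by
  have h := hD.contMDiff.contMDiff (σ := Y) hY.contMDiffOn
  rw [contMDiffOn_univ] at h
  exact ContMDiff.clm_bundle_apply (F₁ := E) (F₂ := E) (E₁ := fun x : M => TangentSpace I x)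
    (E₂ := fun x : M => TangentSpace I x) (ϕ := fun x => D Y x) (v := X) h hX

theorem contMDiff_derivMetricTensor (hD : CovariantDerivative.ContMDiffCovariantDerivative D ∞)
    {X Y Z : (x : M) → TangentSpace I x} (hX : CMDiff ∞ (T% X)) (hY : CMDiff ∞ (T% Y))
    (hZ : CMDiff ∞ (T% Z)) : CMDiff ∞ (fun x => D.derivMetricTensor x (X x) (Y x) (Z x)) := by
  have h : CMDiff ∞ (fun x => mvfderiv I (fun y => (inner ℝ (X y) (Y y) : ℝ)) x (Z x)
      - inner ℝ (D X x (Z x)) (Y x) - inner ℝ (X x) (D Y x (Z x))) :=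
    ((contMDiff_mvfderiv_apply (contMDiff_inner hX hY) hZ).sub
      (contMDiff_inner (contMDiff_covariantDerivative_apply hD hZ hX) hY)).sub
      (contMDiff_inner hX (contMDiff_covariantDerivative_apply hD hZ hY))
  refine h.congr fun x => ?_
  rw [mvfderiv_inner (D := D) (hX.mdifferentiable (by simp) x) (hY.mdifferentiable (by simp) x)]
  ring

/-- The Levi-Civita connection `D₀` is not assumed to be smooth here; `D` is, and the cubic form of
`D - D₀` is a multiple of the derivative of the metric along `D`. -/
theorem contMDiff_differenceTensor [T2Space M] (hD : IsStatistical D) (h₀ : IsLeviCivita D₀)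
    {X Y : (x : M) → TangentSpace I x} (hX : CMDiff ∞ (T% X)) (hY : CMDiff ∞ (T% Y)) :
    CMDiff ∞ (T% (fun x => differenceTensor D D₀ x (X x) (Y x))) := by
  intro x
  refine contMDiffAt_of_inner fun Z hZ => ?_
  simp only [inner_differenceTensor hD h₀]
  exact contMDiffAt_const.mul (contMDiff_derivMetricTensor hD.smooth hY hZ hX x)

/-- On a statistical manifold of constant Hessian curvature `c`, the difference tensor satisfies the
algebraic identity that the second fundamental form of a hypersurface of constant curvature `c/4`
in a flat space does. -/
theorem HasConstantHessianCurvature.exists_isLeviCivita_gauss [T2Space M] (hD : IsStatistical D)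
    {c : ℝ} (hc : HasConstantHessianCurvature D c) :
    ∃ D₀ : CovariantDerivative I E (fun x : M => TangentSpace I x), IsLeviCivita D₀ ∧
      ∀ (x : M) (u v w z : TangentSpace I x),
        (inner ℝ (differenceTensor D D₀ x u v) (differenceTensor D D₀ x w z) : ℝ)
          - inner ℝ (differenceTensor D D₀ x u w) (differenceTensor D D₀ x v z)
        = c / 4 * (inner ℝ u v * inner ℝ w z - inner ℝ u w * inner ℝ v z) := by
  obtain ⟨D₀, h₀, hK⟩ := hc
  refine ⟨D₀, h₀, fun x u v w z => ?_⟩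
  obtain ⟨X, hX, hXu⟩ := exists_contMDiff_extend u
  obtain ⟨Z, hZ, hZz⟩ := exists_contMDiff_extend z
  -- The product rule for `⟨K(Y, Z), W⟩`, with `∇K` replaced by its given value.
  have key : ∀ Y W : (x : M) → TangentSpace I x, CMDiff ∞ (T% Y) → CMDiff ∞ (T% W) →
      mvfderiv I (fun y => (inner ℝ (differenceTensor D D₀ y (Y y) (Z y)) (W y) : ℝ)) x (X x)
        = -2 * inner ℝ (differenceTensor D D₀ x (X x) (W x)) (differenceTensor D D₀ x (Y x) (Z x))
          - c / 2 * (inner ℝ (X x) (Y x) * inner ℝ (Z x) (W x)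
            + inner ℝ (X x) (Z x) * inner ℝ (Y x) (W x))
          + inner ℝ (differenceTensor D D₀ x (D Y x (X x)) (Z x)) (W x)
          + inner ℝ (differenceTensor D D₀ x (Y x) (D Z x (X x))) (W x)
          + inner ℝ (differenceTensor D D₀ x (Y x) (Z x)) (D W x (X x)) := by
    intro Y W hY hW
    have hKYZ := contMDiff_differenceTensor hD h₀ hY hZ
    rw [mvfderiv_inner (D := D) (X := fun y => differenceTensor D D₀ y (Y y) (Z y))
      (hKYZ.mdifferentiable (by simp) x) (hW.mdifferentiable (by simp) x)]
    have e1 := hK X Y Z hX hY hZ x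
    rw [covDerivTensor, sub_sub, sub_eq_iff_eq_add] at e1
    rw [e1, derivMetricTensor_symm]
    have e2 := inner_differenceTensor hD h₀ x (X x) (W x) (differenceTensor D D₀ x (Y x) (Z x))
    simp only [inner_add_left, real_inner_smul_left]
    linarith
  obtain ⟨Y, hY, hYw⟩ := exists_contMDiff_extend w
  obtain ⟨W, hW, hWv⟩ := exists_contMDiff_extend v
  have hs := differenceTensor_symm hD.torsion_eq_zero h₀.torsion_eq_zero
  have hcycle : ∀ (y : M) (a b d : TangentSpace I y),
      (inner ℝ (differenceTensor D D₀ y a b) d : ℝ) = inner ℝ (differenceTensor D D₀ y d b) a :=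
    fun y a b d => by
      rw [hs y a b, inner_differenceTensor_comm hD h₀, hs y b d]
  have e1 := key Y W hY hW
  have e2 := key W Y hW hY
  -- Total symmetry: exchanging `Y` and `W` does not change the differentiated function.
  have hfun : (fun y => (inner ℝ (differenceTensor D D₀ y (Y y) (Z y)) (W y) : ℝ))
      = fun y => inner ℝ (differenceTensor D D₀ y (W y) (Z y)) (Y y) :=
    funext fun y => hcycle y _ _ _
  rw [hfun, e2] at e1
  rw [hcycle x (W x) (Z x) (D Y x (X x)), hcycle x (W x) (D Z x (X x)) (Y x),
    hcycle x (D W x (X x)) (Z x) (Y x), real_inner_comm (W x) (Z x), real_inner_comm (Y x) (Z x),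
    real_inner_comm (W x) (Y x)] at e1
  rw [← hXu, ← hZz, ← hYw, ← hWv]
  linear_combination e1 / 2

end Statistical

/-! ### Vector fields along a map -/

section AlongMap

variable {E : Type*} [NormedAddCommGroup E] [NormedSpace ℝ E] [FiniteDimensional ℝ E]
  {H : Type*} [TopologicalSpace H] {I : ModelWithCorners ℝ E H}
  {M : Type*} [TopologicalSpace M] [ChartedSpace H M] [IsManifold I ∞ M]
  {E' : Type*} [NormedAddCommGroup E'] [NormedSpace ℝ E'] [FiniteDimensional ℝ E']
  {H' : Type*} [TopologicalSpace H'] {J : ModelWithCorners ℝ E' H'}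
  {N : Type*} [TopologicalSpace N] [ChartedSpace H' N] [IsManifold J ∞ N]

omit [FiniteDimensional ℝ E] [IsManifold I ∞ M] in
theorem mvfderiv_congr {φ ψ : M → ℝ} {x : M} (h : φ =ᶠ[𝓝 x] ψ) :
    mvfderiv I φ x = mvfderiv I ψ x := by
  have h' := h.mfderiv_eq (I := I) (I' := 𝓘(ℝ, ℝ))
  ext v
  exact congr($h' v)

omit [FiniteDimensional ℝ E] [IsManifold I ∞ M] in
theorem mvfderiv_sum_mul {ι : Type*} (s : Finset ι) {a h : ι → M → ℝ} {x : M}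
    (ha : ∀ i, MDiffAt (a i) x) (hh : ∀ i, MDiffAt (h i) x) :
    MDiffAt (fun z => ∑ i ∈ s, a i z * h i z) x ∧
    ∀ v : TangentSpace I x, mvfderiv I (fun z => ∑ i ∈ s, a i z * h i z) x v
      = ∑ i ∈ s, (a i x * mvfderiv I (h i) x v + mvfderiv I (a i) x v * h i x) := by
  classical
  induction s using Finset.induction_on with
  | empty =>
    simp only [Finset.sum_empty]
    exact ⟨mdifferentiableAt_const, fun v => by rw [mvfderiv_const]; rfl⟩
  | insert i s hi ih =>
    have hm : MDiffAt (fun z => a i z * h i z) x := (ha i).mul (hh i)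
    simp only [Finset.sum_insert hi]
    refine ⟨hm.add ih.1, fun v => ?_⟩
    rw [mvfderiv_fun_add hm ih.1, mvfderiv_fun_mul (ha i) (hh i)]
    simp [ih.2 v]
    ring

omit [FiniteDimensional ℝ E] [IsManifold I ∞ M] in
theorem mvfderiv_clm_comp {F : Type*} [NormedAddCommGroup F] [NormedSpace ℝ F] (L : F →L[ℝ] ℝ)
    {V : M → F} {x : M} (hV : MDiffAt V x) :
    MDiffAt (fun z => L (V z)) x ∧
      ∀ v : TangentSpace I x, mvfderiv I (fun z => L (V z)) x v = L (mvfderiv I V x v) := by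
  refine ⟨L.mdifferentiableAt.comp x hV, fun v => ?_⟩
  have h := mfderiv_comp_apply x (g := L) L.mdifferentiableAt hV v
  rw [L.mfderiv_eq] at h
  exact h

variable [RiemannianBundle (fun y : N => TangentSpace J y)]
  [IsContMDiffRiemannianBundle J ∞ E' (fun y : N => TangentSpace J y)]

omit [FiniteDimensional ℝ E] [IsManifold I ∞ M] in
/-- The part of the product rule along `f` that differentiates the coefficients of `V`: up to the term
in `dV`, the field `V` may be replaced by the field on `N` with the constant coefficients `V x`. -/
theorem mvfderiv_inner_freeze {f : M → N} {V W : (x : M) → TangentSpace J (f x)} {x : M}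
    (hV : MDifferentiableAt I J.tangent (fun z => (⟨f z, V z⟩ : TangentBundle J N)) x)
    (hW : MDifferentiableAt I J.tangent (fun z => (⟨f z, W z⟩ : TangentBundle J N)) x)
    (v : TangentSpace I x) :
    mvfderiv I (fun z => (inner ℝ (V z) (W z) : ℝ)) x v
      = mvfderiv I (fun z => (inner ℝ
          (FiberBundle.extend (E := fun y : N => TangentSpace J y) E' (V x) (f z)) (W z) : ℝ)) x v
        + inner ℝ ((trivializationAt E' (fun y : N => TangentSpace J y) (f x)).symmL ℝ (f x)
            (mvfderiv I (fun z : M => (trivializationAt E' (fun y : N => TangentSpace J y) (f x)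
              ⟨f z, V z⟩).2) x v)) (W x) := by
  set e := trivializationAt E' (fun y : N => TangentSpace J y) (f x) with he
  have hfx : f x ∈ e.baseSet := FiberBundle.mem_baseSet_trivializationAt' (f x)
  obtain ⟨hf, hVe⟩ := (mdifferentiableAt_totalSpace J (F := E')
    (E := fun y : N => TangentSpace J y) (fun z => (⟨f z, V z⟩ : TangentBundle J N))).1 hV
  change MDiffAt f x at hf
  change MDiffAt (fun z => (e ⟨f z, V z⟩).2) x at hVe
  obtain ⟨n, ⟨b⟩⟩ : ∃ n : ℕ, Nonempty (Module.Basis (Fin n) ℝ E') := ⟨_, ⟨Module.finBasis ℝ E'⟩⟩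
  -- `s i` is the frame vector field with the constant coefficients `b i` near `f x`.
  let s : Fin n → (y : N) → TangentSpace J y := fun i =>
    FiberBundle.extend (E := fun y : N => TangentSpace J y) E' (e.symm (f x) (b i))
  have hs : ∀ i y, s i y = e.symm y (b i) := fun i y => by
    simp only [s, FiberBundle.extend, ← he]
    rw [e.apply_mk_symm hfx]
  have hsf : ∀ i, MDifferentiableAt I J.tangent (fun z => (⟨f z, s i (f z)⟩ : TangentBundle J N)) x :=
    fun i => (FiberBundle.mdifferentiableAt_extend J E' (V := fun y : N => TangentSpace J y)
      (e.symm (f x) (b i))).comp x hf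
  have hext : MDifferentiableAt I J.tangent (fun z => (⟨f z,
      FiberBundle.extend (E := fun y : N => TangentSpace J y) E' (V x) (f z)⟩ :
        TangentBundle J N)) x :=
    (FiberBundle.mdifferentiableAt_extend J E' (V := fun y : N => TangentSpace J y)
      (V x)).comp x hf
  let L : Fin n → E' →L[ℝ] ℝ := fun i => LinearMap.toContinuousLinearMap (b.coord i)
  let V₀ : M → E' := fun z => (e ⟨f z, V z⟩).2
  -- The coefficients of `V` minus those of the frozen field; they vanish at `x`, so the derivatives
  -- of the `h i` do not contribute there.
  let a : Fin n → M → ℝ := fun i z => L i (V₀ z) - L i (V₀ x)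
  let h : Fin n → M → ℝ := fun i z => inner ℝ (s i (f z)) (W z)
  have ha : ∀ i, MDiffAt (a i) x := fun i =>
    (mvfderiv_clm_comp (L i) hVe).1.sub mdifferentiableAt_const
  have hh : ∀ i, MDiffAt (h i) x := fun i => mdifferentiableAt_inner (hsf i) hW
  have hrep : ∀ y ∈ e.baseSet, ∀ u : E', e.symm y u = ∑ i, L i u • s i y := fun y hy u => by
    have h := congrArg (e.symmL ℝ y) (b.sum_repr u)
    rw [map_sum, e.symmL_apply hy] at h
    rw [← h]
    refine Finset.sum_congr rfl fun i _ => ?_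
    rw [map_smul, e.symmL_apply hy, hs]
    rfl
  have hsum : (fun z => (inner ℝ (V z) (W z) : ℝ)) =ᶠ[𝓝 x] fun z => (inner ℝ
      (FiberBundle.extend (E := fun y : N => TangentSpace J y) E' (V x) (f z)) (W z) : ℝ)
        + ∑ i, a i z * h i z := by
    filter_upwards [hf.continuousAt.preimage_mem_nhds (e.open_baseSet.mem_nhds hfx)] with z hz
    have hrep := hrep (f z) hz
    have h1 : V z = e.symm (f z) (V₀ z) := (e.symm_apply_apply_mk hz (V z)).symm
    have h2 : FiberBundle.extend (E := fun y : N => TangentSpace J y) E' (V x) (f z)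
      = e.symm (f z) (V₀ x) := rfl
    rw [h2, h1, hrep, hrep, sum_inner, sum_inner, ← Finset.sum_add_distrib]
    refine Finset.sum_congr rfl fun i _ => ?_
    simp only [real_inner_smul_left, a, h]
    ring
  obtain ⟨hm, hd⟩ := mvfderiv_sum_mul Finset.univ ha hh
  rw [mvfderiv_congr hsum, mvfderiv_fun_add (mdifferentiableAt_inner hext hW) hm,
    add_apply, hd v]
  congr 1
  change _ = inner ℝ (e.symmL ℝ (f x) (mvfderiv I V₀ x v)) (W x)
  rw [e.symmL_apply hfx, hrep (f x) hfx, sum_inner]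
  refine Finset.sum_congr rfl fun i _ => ?_
  have hda : mvfderiv I (a i) x v = L i (mvfderiv I V₀ x v) := by
    have hL := mvfderiv_clm_comp (L i) hVe
    rw [← hL.2 v]
    simp only [a]
    rw [mvfderiv_fun_sub hL.1 mdifferentiableAt_const, mvfderiv_const, sub_zero]
  rw [hda, real_inner_smul_left]
  simp only [a, h, sub_self, zero_mul, zero_add]

omit [FiniteDimensional ℝ E] [IsManifold I ∞ M] in
/-- The product rule for the pull-back connection:
`v⟨V, W⟩ = (∇_{f_* v} g)(V, W) + ⟨∇_v V, W⟩ + ⟨V, ∇_v W⟩` for vector fields `V`, `W` along `f`. -/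
theorem mvfderiv_inner_along {D : CovariantDerivative J E' (fun y : N => TangentSpace J y)}
    {f : M → N} {V W : (x : M) → TangentSpace J (f x)} {x : M}
    (hV : MDifferentiableAt I J.tangent (fun z => (⟨f z, V z⟩ : TangentBundle J N)) x)
    (hW : MDifferentiableAt I J.tangent (fun z => (⟨f z, W z⟩ : TangentBundle J N)) x)
    (v : TangentSpace I x) :
    mvfderiv I (fun z => (inner ℝ (V z) (W z) : ℝ)) x v
      = D.derivMetricTensor (f x) (V x) (W x) (mfderiv I J f x v)
        + inner ℝ (covAlong (I := I) D f V x v) (W x)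
        + inner ℝ (V x) (covAlong (I := I) D f W x v) := by
  have hf : MDiffAt f x := ((mdifferentiableAt_totalSpace J (F := E')
    (E := fun y : N => TangentSpace J y) (fun z => (⟨f z, V z⟩ : TangentBundle J N))).1 hV).1
  have hVx := FiberBundle.mdifferentiableAt_extend J E' (V := fun y : N => TangentSpace J y) (V x)
  have hWx := FiberBundle.mdifferentiableAt_extend J E' (V := fun y : N => TangentSpace J y) (W x)
  have e1 := mvfderiv_inner_freeze hV hW v
  have e2 := mvfderiv_inner_freeze hW (V := W) (W := fun z =>
    FiberBundle.extend (E := fun y : N => TangentSpace J y) E' (V x) (f z)) (hVx.comp x hf) v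
  have e3 : mvfderiv I (fun z => (inner ℝ
      (FiberBundle.extend (E := fun y : N => TangentSpace J y) E' (W x) (f z))
      (FiberBundle.extend (E := fun y : N => TangentSpace J y) E' (V x) (f z)) : ℝ)) x v = _ :=
    mvfderiv_comp_apply x (mdifferentiableAt_inner hWx hVx) hf v
  have e4 := mvfderiv_inner (D := D) hWx hVx (mfderiv I J f x v)
  simp only [FiberBundle.extend_apply_self] at e2 e3 e4
  have e5 : (fun z => (inner ℝ (FiberBundle.extend (E := fun y : N => TangentSpace J y) E' (V x)
      (f z)) (W z) : ℝ)) = fun z => inner ℝ (W z)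
        (FiberBundle.extend (E := fun y : N => TangentSpace J y) E' (V x) (f z)) :=
    funext fun z => real_inner_comm _ _
  -- `covAlong` is defined with the same constant-coefficient extension as `FiberBundle.extend`.
  have e6 : covAlong (I := I) D f V x v
      = (trivializationAt E' (fun y : N => TangentSpace J y) (f x)).symmL ℝ (f x)
            (mvfderiv I (fun z : M => (trivializationAt E' (fun y : N => TangentSpace J y) (f x)
              ⟨f z, V z⟩).2) x v)
        + D (FiberBundle.extend (E := fun y : N => TangentSpace J y) E' (V x)) (f x)
            (mfderiv I J f x v) := rfl
  have e7 : covAlong (I := I) D f W x v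
      = (trivializationAt E' (fun y : N => TangentSpace J y) (f x)).symmL ℝ (f x)
            (mvfderiv I (fun z : M => (trivializationAt E' (fun y : N => TangentSpace J y) (f x)
              ⟨f z, W z⟩).2) x v)
        + D (FiberBundle.extend (E := fun y : N => TangentSpace J y) E' (W x)) (f x)
            (mfderiv I J f x v) := rfl
  rw [e1, e5, e2]
  rw [e6, e7, inner_add_left, inner_add_right]
  rw [e3, e4, derivMetricTensor_symm D (f x) (V x) (W x),
    real_inner_comm _ (V x), real_inner_comm _ (V x), real_inner_comm _ (W x)]
  ring

end AlongMap

/-! ### The algebra at a point of a hypersurface -/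

/-- Let `L` embed `A`, of dimension at least two, as the hyperplane orthogonal to the unit vector `ξ`.
If a symmetric bilinear map `K` satisfies the Gauss type identity with a constant `c ≠ 0` and
`K` of tangent vectors is normal, then `⟨K(L a, ξ), ξ⟩ = 0`. -/
theorem inner_normal_eq_zero_of_gauss {A B : Type*} [AddCommGroup A] [Module ℝ A]
    [FiniteDimensional ℝ A] [NormedAddCommGroup B] [InnerProductSpace ℝ B] [FiniteDimensional ℝ B]
    (hA : 2 ≤ Module.finrank ℝ A) (hdim : Module.finrank ℝ B = Module.finrank ℝ A + 1)
    (L : A →ₗ[ℝ] B) (hL : ∀ u, L u = 0 → u = 0) (ξ : B) (hξ : inner ℝ ξ ξ = (1 : ℝ))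
    (hn : ∀ a, inner ℝ (L a) ξ = (0 : ℝ)) (K : B →ₗ[ℝ] B →ₗ[ℝ] B) (hK : ∀ u v, K u v = K v u)
    {c : ℝ} (hc : c ≠ 0)
    (hgauss : ∀ u v w z : B, (inner ℝ (K u v) (K w z) : ℝ) - inner ℝ (K u w) (K v z)
      = c / 4 * (inner ℝ u v * inner ℝ w z - inner ℝ u w * inner ℝ v z))
    (hT : ∀ u v w, inner ℝ (K (L u) (L v)) (L w) = (0 : ℝ)) (a : A) :
    inner ℝ (K (L a) ξ) ξ = (0 : ℝ) := by
  have hker : ∀ τ : A →ₗ[ℝ] ℝ, ∃ z, z ≠ 0 ∧ τ z = 0 := fun τ => by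
    have h : τ.ker ≠ ⊥ := LinearMap.ker_ne_bot_of_finrank_lt (by simp; omega)
    obtain ⟨z, hz, hz0⟩ := Submodule.exists_mem_ne_zero_of_ne_bot h
    exact ⟨z, hz0, hz⟩
  have hnormal : ∀ u v, K (L u) (L v) = (inner ℝ (K (L u) (L v)) ξ : ℝ) • ξ := fun u v => by
    obtain ⟨w, hw⟩ := exists_eq_of_orthogonal hdim L hL ξ hξ hn
      (K (L u) (L v) - (inner ℝ (K (L u) (L v)) ξ : ℝ) • ξ)
      (by rw [inner_sub_left, real_inner_smul_left, hξ]; ring)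
    have h0 : inner ℝ (L w) (L w) = (0 : ℝ) := by
      nth_rewrite 1 [hw]
      rw [inner_sub_left, real_inner_smul_left, hT, real_inner_comm (L w) ξ, hn]
      ring
    rw [inner_self_eq_zero.1 h0] at hw
    exact (sub_eq_zero.1 hw.symm)
  by_contra ha
  obtain ⟨z, hz0, hz⟩ := hker
    { toFun := fun v => inner ℝ (K (L v) ξ) ξ
      map_add' := fun u v => by simp [inner_add_left]
      map_smul' := fun r v => by simp [real_inner_smul_left] }
  have hz' : (inner ℝ (K (L z) ξ) ξ : ℝ) = 0 := hz
  -- The identity with the arguments `a, ξ, y, z` reads `b(y, z) τ(a) = b(a, y) τ(z) = 0`.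
  have hKz : ∀ y, K (L z) (L y) = 0 := fun y => by
    have h := hgauss (L a) ξ (L y) (L z)
    rw [hn, real_inner_comm (L z) ξ, hn, hnormal y z, hnormal a y, real_inner_smul_right,
      real_inner_smul_left, hK ξ, real_inner_comm _ ξ, hz'] at h
    have h' : (inner ℝ (K (L y) (L z)) ξ : ℝ) = 0 := by
      have : (inner ℝ (K (L y) (L z)) ξ : ℝ) * inner ℝ (K (L a) ξ) ξ = 0 := by linarith
      exact (mul_eq_zero.1 this).resolve_right ha
    rw [hK, hnormal, h', zero_smul]
  obtain ⟨y, hy0, hy⟩ := hker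
    { toFun := fun v => inner ℝ (L v) (L z)
      map_add' := fun u v => by simp [inner_add_left]
      map_smul' := fun r v => by simp [real_inner_smul_left] }
  have hy' : (inner ℝ (L y) (L z) : ℝ) = 0 := hy
  have h := hgauss (L z) (L z) (L y) (L y)
  rw [hKz, hKz, inner_zero_left, inner_zero_left, real_inner_comm (L y) (L z), hy'] at h
  have hzz : (inner ℝ (L z) (L z) : ℝ) ≠ 0 := fun h0 => hz0 (hL z (inner_self_eq_zero.1 h0))
  have hyy : (inner ℝ (L y) (L y) : ℝ) ≠ 0 := fun h0 => hy0 (hL y (inner_self_eq_zero.1 h0))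
  have : c / 4 * (inner ℝ (L z) (L z) * inner ℝ (L y) (L y)) ≠ 0 :=
    mul_ne_zero (div_ne_zero hc (by norm_num)) (mul_ne_zero hzz hyy)
  exact this (by linarith)

/-! ### Statistical immersions of codimension one -/

section Immersion

variable {E : Type*} [NormedAddCommGroup E] [NormedSpace ℝ E] [FiniteDimensional ℝ E]
  {H : Type*} [TopologicalSpace H] {I : ModelWithCorners ℝ E H}
  {M : Type*} [TopologicalSpace M] [ChartedSpace H M] [IsManifold I ∞ M]
  {E' : Type*} [NormedAddCommGroup E'] [NormedSpace ℝ E'] [FiniteDimensional ℝ E']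
  {H' : Type*} [TopologicalSpace H'] {J : ModelWithCorners ℝ E' H'}
  {N : Type*} [TopologicalSpace N] [ChartedSpace H' N] [IsManifold J ∞ N]
  [RiemannianBundle (fun x : M => TangentSpace I x)]
  [IsContMDiffRiemannianBundle I ∞ E (fun x : M => TangentSpace I x)]
  [RiemannianBundle (fun y : N => TangentSpace J y)]
  [IsContMDiffRiemannianBundle J ∞ E' (fun y : N => TangentSpace J y)]
  {D : CovariantDerivative I E (fun x : M => TangentSpace I x)}
  {D' : CovariantDerivative J E' (fun y : N => TangentSpace J y)} {f : M → N}

/-- If the induced connection is metric, the cubic form of the ambient manifold vanishes on tangent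
vectors: the product rules on `M` and along `f` differ only by this term. -/
theorem IsStatisticalImmersion.derivMetricTensor_eq_zero [T2Space M] (hD : IsLeviCivita D)
    (hf : IsStatisticalImmersion D D' f) (x : M) (u v w : TangentSpace I x) :
    D'.derivMetricTensor (f x) (mfderiv I J f x u) (mfderiv I J f x v) (mfderiv I J f x w) = 0 := by
  obtain ⟨X, hX, rfl⟩ := exists_contMDiff_extend u
  obtain ⟨Y, hY, rfl⟩ := exists_contMDiff_extend v
  have hfs : ContMDiff I J ∞ f := hf.immersion.contMDiff
  have hpush : ∀ Z : (x : M) → TangentSpace I x, CMDiff ∞ (T% Z) →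
      MDifferentiableAt I J.tangent
        (fun z => (⟨f z, mfderiv I J f z (Z z)⟩ : TangentBundle J N)) x := fun Z hZ =>
    (((hfs.contMDiff_tangentMap (m := ∞) le_rfl).comp hZ).mdifferentiable (by simp)) x
  have e1 := mvfderiv_inner_along (D := D') (hpush X hX) (hpush Y hY) w
  have e2 := mvfderiv_inner (D := D) (hX.mdifferentiable (by simp) x)
    (hY.mdifferentiable (by simp) x) w
  have e3 : D.derivMetricTensor x (X x) (Y x) w = 0 := congr($(hD.metric) x (X x) (Y x) w)
  simp only [← hf.metric] at e1
  have e4 := hf.connection X hX x w (Y x)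
  have e5 := hf.connection Y hY x w (X x)
  rw [real_inner_comm _ (mfderiv I J f x (X x))] at e1
  rw [real_inner_comm _ (X x)] at e2
  linarith

omit [FiniteDimensional ℝ E] [IsManifold I ∞ M] [RiemannianBundle (fun x : M => TangentSpace I x)]
  [IsContMDiffRiemannianBundle I ∞ E (fun x : M => TangentSpace I x)] in
/-- Differentiating `⟨ξ, ξ⟩ = 1` expresses `τ*` without derivatives of `ξ`. -/
theorem IsUnitNormalOn.tauStar_eq {ξ : (x : M) → TangentSpace J (f x)} {U : Set M}
    (hU : IsOpen U) (hξ : IsUnitNormalOn I f ξ U) {x : M} (hx : x ∈ U) (v : TangentSpace I x) :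
    tauStar (I := I) D' f ξ x v
      = -(1 / 2) * D'.derivMetricTensor (f x) (ξ x) (ξ x) (mfderiv I J f x v) := by
  have hd := (hξ.smooth.contMDiffAt (hU.mem_nhds hx)).mdifferentiableAt (by simp)
  have e1 := mvfderiv_inner_along (D := D') hd hd v
  have e2 : (fun z => (inner ℝ (ξ z) (ξ z) : ℝ)) =ᶠ[𝓝 x] fun _ => (1 : ℝ) := by
    filter_upwards [hU.mem_nhds hx] with z hz using hξ.unit z hz
  have e3 : mvfderiv I (fun z => (inner ℝ (ξ z) (ξ z) : ℝ)) x v = 0 := by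
    rw [mvfderiv_congr e2, mvfderiv_const]
    rfl
  rw [e3, real_inner_comm _ (ξ x)] at e1
  rw [tauStar]
  linarith

theorem isEquiaffine_of_isTrivial [T2Space M] [T2Space N] (hE : 2 ≤ Module.finrank ℝ E)
    (hdim : Module.finrank ℝ E' = Module.finrank ℝ E + 1) (hD : IsLeviCivita D)
    (hD' : IsStatistical D') {c : ℝ} (hc : c ≠ 0) (hDc : HasConstantHessianCurvature D' c)
    (hf : IsStatisticalImmersion D D' f) : IsEquiaffine I D' f := by
  intro U ξ hU hξ x hx v
  obtain ⟨D₀, h₀, hgauss⟩ := hDc.exists_isLeviCivita_gauss hD'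
  have : FiniteDimensional ℝ (TangentSpace I x) := inferInstanceAs (FiniteDimensional ℝ E)
  have : FiniteDimensional ℝ (TangentSpace J (f x)) := inferInstanceAs (FiniteDimensional ℝ E')
  have hE' : 2 ≤ Module.finrank ℝ (TangentSpace I x) := hE
  have hdim' : Module.finrank ℝ (TangentSpace J (f x)) = Module.finrank ℝ (TangentSpace I x) + 1 :=
    hdim
  have hs := differenceTensor_symm hD'.torsion_eq_zero h₀.torsion_eq_zero (f x)
  -- `difference` takes the direction as its second argument; the symmetry of `K` absorbs this.
  let K : TangentSpace J (f x) →ₗ[ℝ] TangentSpace J (f x) →ₗ[ℝ] TangentSpace J (f x) :=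
    ContinuousLinearMap.coeLM ℝ ∘ₗ (D'.difference D₀ (f x)).toLinearMap
  have hK : ∀ u w, K u w = differenceTensor D' D₀ (f x) u w := fun u w => hs w u
  have hinj : ∀ u : TangentSpace I x, mfderiv I J f x u = 0 → u = 0 := fun u hu => by
    have := hf.metric x u u
    rw [hu, inner_zero_left] at this
    exact inner_self_eq_zero.1 this
  have h := inner_normal_eq_zero_of_gauss hE' hdim'
    (mfderiv I J f x).toLinearMap hinj (ξ x) (hξ.unit x hx) (hξ.normal x hx) K
    (fun u w => by rw [hK, hK, hs]) hc
    (fun u w z t => by simp only [hK]; exact hgauss (f x) u w z t)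
    (fun u w z => by
      rw [hK, inner_differenceTensor hD' h₀]
      exact mul_eq_zero_of_right _ (hf.derivMetricTensor_eq_zero hD x w z u)) v
  rw [hK, inner_differenceTensor hD' h₀] at h
  rw [hξ.tauStar_eq hU hx]
  exact h

end Immersion

end StatGeom

theorem corollary4p1 {n : ℕ} (hn : 2 ≤ n)
    {M : Type*} [TopologicalSpace M] [T2Space M] [SecondCountableTopology M]
    [ChartedSpace (EuclideanSpace ℝ (Fin n)) M] [IsManifold (𝓡 n) ∞ M]
    [RiemannianBundle (fun x : M => TangentSpace (𝓡 n) x)]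
    [IsContMDiffRiemannianBundle (𝓡 n) ∞ (EuclideanSpace ℝ (Fin n))
      (fun x : M => TangentSpace (𝓡 n) x)]
    {N : Type*} [TopologicalSpace N] [T2Space N] [SecondCountableTopology N]
    [ChartedSpace (EuclideanSpace ℝ (Fin (n + 1))) N] [IsManifold (𝓡 (n + 1)) ∞ N]
    [RiemannianBundle (fun y : N => TangentSpace (𝓡 (n + 1)) y)]
    [IsContMDiffRiemannianBundle (𝓡 (n + 1)) ∞ (EuclideanSpace ℝ (Fin (n + 1)))
      (fun y : N => TangentSpace (𝓡 (n + 1)) y)]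
    (D : CovariantDerivative (𝓡 n) (EuclideanSpace ℝ (Fin n))
      (fun x : M => TangentSpace (𝓡 n) x))
    (D' : CovariantDerivative (𝓡 (n + 1)) (EuclideanSpace ℝ (Fin (n + 1)))
      (fun y : N => TangentSpace (𝓡 (n + 1)) y))
    (k c : ℝ) (hc : c ≠ 0)
    (hM : StatGeom.IsTrivialStatistical D) (hMk : StatGeom.HasConstantCurvature D k)
    (hN : StatGeom.IsHessian D') (hNc : StatGeom.HasConstantHessianCurvature D' c)
    (f : M → N) (hf : StatGeom.IsStatisticalImmersion D D' f) :
    StatGeom.IsEquiaffine (𝓡 n) D' f := by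
  exact StatGeom.isEquiaffine_of_isTrivial (by simpa using hn) (by simp) hM.leviCivita
    hN.statistical hc hNc hf
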